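/- **Setting.** Fix natural numbers $c,d$. A network configuration is a triple $(G,\mathsf{id},I)$, where $G$ is a simple connected graph with $n\ge 1$ nodes, $\mathsf{id}:V(G)\to\{1,\dots,n^c\}$ is injective, and $I:V(G)\to\{0,1\}^*$ assigns to each node an input label of at most $d(\lfloor\log_2 n\rfloor+1)$ bits. Configurations are considered up to isomorphisms preserving $\mathsf{id}$ and $I$. A distributed language is a Turing-decidable collection $\mathcal L$ of network configurations. A cograph is a graph with no induced path on four nodes, and $\mathcal L_{\text{cograph}}=\{(G,\mathsf{id},I)\in\mathcal L: G\text{ is a cograph}\}$. A two-round Arthur–Merlin protocol with shared randomness and bandwidth $O(\log n)$ runs as follows. A uniformly random string $r$ of $O(\log n)$ bits, whose length depends only on $\lfloor \log_2 n\rfloor$, is drawn and is seen by all nodes and by the prover. The prover, who knows $(G,\mathsf{id},I)$ and is computationally unbounded, then sends a certificate to each node $v$ (a function of $v$, $r$ and the configuration). Each node then broadcasts to its neighbours a single message computed from its identifier, its input label, $r$ and its certificate. Finally each node accepts or rejects on the basis of these data and of the multiset of messages received from its neighbours. The nodes run the same algorithm (a computable message function and a computable verdict function), which depends neither on $G$ nor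 on $n$. The messages always have $O(\log n)$ bits, with a uniform constant. Such a protocol decides $\mathcal L'$ with error $\varepsilon(n)$ if, for every network configuration $(G,\mathsf{id},I)$ with $n$ nodes: * (completeness) if $(G,\mathsf{id},I)\in\mathcal L'$, some prover, with certificates of $O(\log n)$ bits (with a uniform constant), makes all nodes accept with probability at least $1-\varepsilon(n)$; * (soundness) if $(G,\mathsf{id},I)\notin\mathcal L'$, then for every prover (with certificates of any length) at least one node rejects with probability at least $1-\varepsilon(n)$. **Theorem.** For all $c,d,k\in\mathbb N$ and every distributed language $\mathcal L$, there is a two-round Arthur–Merlin protocol with shared randomness and bandwidth $O(\log n)$ that decides $\mathcal L_{\text{cograph}}$ with error $\varepsilon(n)=\min\{1/3,\,n^{-k}\}$. In particular $\mathcal L_{\text{cograph}}\in\mathsf{dAM}[\log n]$, with shared randomness and with high probability of a correct answer. -/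

import Mathlib

namespace DistributedProof

/-- A graph `G` on `n` nodes together with identifiers and input labels for its nodes. -/
structure NetworkConfig where
  n : ℕ
  graph : SimpleGraph (Fin n)
  ident : Fin n → ℕ
  input : Fin n → List Bool

/-- The legal network configurations with identifier exponent `c` and input constant `d`:
the graph is connected, the identifiers are distinct and lie in `{1, …, n ^ c}`, and each
input label has at most `d * (⌊log₂ n⌋ + 1)` bits. -/
structure NetworkConfig.IsNetwork (c d : ℕ) (C : NetworkConfig) : Prop where
  connected : C.graph.Connected
  ident_injective : Function.Injective C.ident
  ident_pos : ∀ v, 1 ≤ C.ident v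
  ident_le : ∀ v, C.ident v ≤ C.n ^ c
  input_le : ∀ v, (C.input v).length ≤ d * (Nat.log 2 C.n + 1)

/-- Two configurations that differ only in the names of the vertices. -/
def NetworkConfig.Isomorphic (C D : NetworkConfig) : Prop :=
  ∃ e : C.graph ≃g D.graph,
    (∀ v, D.ident (e v) = C.ident v) ∧ (∀ v, D.input (e v) = C.input v)

open Classical in
/-- The finite description of a configuration: for every node its identifier, its input label
and its row of the adjacency matrix. -/
noncomputable def NetworkConfig.code (C : NetworkConfig) : List (ℕ × List Bool × List Bool) :=
  List.ofFn fun v : Fin C.n =>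
    (C.ident v, C.input v, List.ofFn fun w : Fin C.n => decide (C.graph.Adj v w))

/-- A distributed language: a Turing-decidable collection of configurations (the names of the
vertices are immaterial, only the identifiers matter). -/
structure IsDistributedLanguage (L : Set NetworkConfig) : Prop where
  iso_invariant : ∀ C D : NetworkConfig, C.Isomorphic D → C ∈ L → D ∈ L
  decidable : ∃ p : List (ℕ × List Bool × List Bool) → Prop,
    ComputablePred p ∧ ∀ C : NetworkConfig, C ∈ L ↔ p C.code

/-- A cograph is a graph without induced path on four nodes. -/
def IsCograph {V : Type*} (G : SimpleGraph V) : Prop :=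
  IsEmpty (SimpleGraph.pathGraph 4 ↪g G)

/-- The restriction of a language to cographs. -/
def restrictToCographs (L : Set NetworkConfig) : Set NetworkConfig :=
  {C | C ∈ L ∧ IsCograph C.graph}

/-- What a node knows before it broadcasts:
its identifier, its input label, the random string and its certificate. -/
abbrev LocalView := ℕ × List Bool × List Bool × List Bool

/-- The verifier of a two-round Arthur-Merlin protocol with shared randomness, measured against
the bandwidth function `f`. On `n`-node graphs the shared random string consists of
`coinRate * f n` bits. The algorithm run by the nodes does not depend on the graph, nor on its
number `n` of nodes. It is given by
* `message`, the message that a node broadcasts to its neighbours;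
* `verdict`, which accepts or rejects on the basis of the local view and of the messages received
  from the neighbours, whose order does not matter. -/
structure Verifier where
  coinRate : ℕ
  message : LocalView → List Bool
  verdict : LocalView × List (List Bool) → Bool
  message_computable : Computable message
  verdict_computable : Computable verdict
  verdict_perm : ∀ (x : LocalView) (l l' : List (List Bool)),
    l.Perm l' → verdict (x, l) = verdict (x, l')

/-- The prover's strategy on an `n`-node graph with `l` random bits: he sees the whole random
string `r` (and the configuration, which is fixed) and sends a certificate to each node. -/
abbrev Prover (n l : ℕ) := (Fin l → Bool) → Fin n → List Bool

/-- The local view of node `v` when the random string is `r` and its certificate is `cert`. -/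
def NetworkConfig.view (C : NetworkConfig) {l : ℕ} (r : Fin l → Bool) (v : Fin C.n)
    (cert : List Bool) : LocalView :=
  (C.ident v, C.input v, List.ofFn r, cert)

open Classical in
/-- Node `v` accepts, given the random string `r` and the certificates sent by the prover. -/
def Verifier.AcceptsAt (V : Verifier) (C : NetworkConfig) {l : ℕ} (P : Prover C.n l)
    (r : Fin l → Bool) (v : Fin C.n) : Prop :=
  V.verdict (C.view r v (P r v),
    ((List.finRange C.n).filter fun w => decide (C.graph.Adj v w)).map
      fun w => V.message (C.view r w (P r w))) = true

open Classical in
/-- The probability of an event under `l` independent fair coin tosses. -/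
noncomputable def coinProb {l : ℕ} (E : (Fin l → Bool) → Prop) : ℝ :=
  ((Finset.univ.filter E).card : ℝ) / 2 ^ l

/-- The class of languages that have a distributed interactive proof with two rounds
(Arthur, then Merlin), shared randomness, bandwidth `O(f n)` and error probability `ε n`, over
configurations with identifier exponent `c` and input constant `d`.
All constants are uniform, and soundness holds against provers whose certificates may have
any length. -/
def dAMPub (c d : ℕ) (ε : ℕ → ℝ) (f : ℕ → ℕ) : Set (Set NetworkConfig) :=
  {L | ∃ (V : Verifier) (K : ℕ), ∀ C : NetworkConfig, C.IsNetwork c d →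
    (∀ (r : Fin (V.coinRate * f C.n) → Bool) (v : Fin C.n) (cert : List Bool),
      (V.message (C.view r v cert)).length ≤ K * f C.n) ∧
    (C ∈ L → ∃ P : Prover C.n (V.coinRate * f C.n),
      (∀ r v, (P r v).length ≤ K * f C.n) ∧
      1 - ε C.n ≤ coinProb fun r => ∀ v, V.AcceptsAt C P r v) ∧
    (C ∉ L → ∀ P : Prover C.n (V.coinRate * f C.n),
      1 - ε C.n ≤ coinProb fun r => ∃ v, ¬ V.AcceptsAt C P r v)}

end DistributedProof

open DistributedProof

namespace DistributedProof

section Cographs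

variable {V : Type*} {G : SimpleGraph V}

theorem isCograph_iff : IsCograph G ↔
    ∀ x y z t, G.Adj x y → G.Adj y z → G.Adj z t → G.Adj x z ∨ G.Adj x t ∨ G.Adj y t := by
  constructor
  · intro h x y z t hxy hyz hzt
    by_contra! hn
    obtain ⟨hxz, hxt, hyt⟩ := hn
    have hxz' : x ≠ z := by rintro rfl; exact hxt hzt
    have hxt' : x ≠ t := by rintro rfl; exact hxz hzt.symm
    have hyt' : y ≠ t := by rintro rfl; exact hxt hxy
    refine h.elim ⟨⟨![x, y, z, t], ?_⟩, ?_⟩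
    · intro i j hij
      fin_cases i <;> fin_cases j <;>
        simp_all [hxy.ne, hyz.ne, hzt.ne, hxy.ne', hyz.ne', hzt.ne', hxz'.symm, hxt'.symm,
          hyt'.symm]
    · intro i j
      change G.Adj (![x, y, z, t] i) (![x, y, z, t] j) ↔ _
      fin_cases i <;> fin_cases j <;>
        simp [SimpleGraph.pathGraph_adj, hxy, hyz, hzt, hxz, hxt, hyt, hxy.symm, hyz.symm,
          hzt.symm, G.adj_comm z x, G.adj_comm t x, G.adj_comm t y]
  · intro h
    refine ⟨fun f => ?_⟩
    have key : ∀ i j, G.Adj (f i) (f j) ↔ (SimpleGraph.pathGraph 4).Adj i j :=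
      fun i j => f.map_rel_iff
    have := h (f 0) (f 1) (f 2) (f 3)
    simp [key, SimpleGraph.pathGraph_adj] at this

theorem IsCograph.compl (hG : IsCograph G) : IsCograph Gᶜ := by
  rw [isCograph_iff] at hG ⊢
  intro x y z t hxy hyz hzt
  by_contra! hn
  obtain ⟨hxz, hxt, hyt⟩ := hn
  have hxz' : x ≠ z := by rintro rfl; exact hxt hzt
  have hxt' : x ≠ t := by rintro rfl; exact hxz hzt.symm
  have hyt' : y ≠ t := by rintro rfl; exact hxt hxy
  simp only [SimpleGraph.compl_adj, not_and, not_not] at *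
  rcases hG y t x z (hyt hyt') (hxt hxt').symm (hxz hxz') with h | h | h
  · exact hxy.2 h.symm
  · exact hyz.2 h
  · exact hzt.2 h.symm

/-- `A` and `B` partition `S` into nonempty parts that are either completely joined or have no edge
between them. -/
structure IsSplit (G : SimpleGraph V) (S A B : Set V) : Prop where
  union_eq : A ∪ B = S
  disjoint : Disjoint A B
  left_nonempty : A.Nonempty
  right_nonempty : B.Nonempty
  uniform : (∀ x ∈ A, ∀ y ∈ B, G.Adj x y) ∨ ∀ x ∈ A, ∀ y ∈ B, ¬ G.Adj x y

theorem IsSplit.symm {S A B : Set V} (h : IsSplit G S A B) : IsSplit G S B A where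
  union_eq := by rw [Set.union_comm, h.union_eq]
  disjoint := h.disjoint.symm
  left_nonempty := h.right_nonempty
  right_nonempty := h.left_nonempty
  uniform := h.uniform.imp (fun h x hx y hy => (h y hy x hx).symm)
    fun h x hx y hy hxy => h y hy x hx hxy.symm

theorem IsSplit.of_compl {S A B : Set V} (h : IsSplit Gᶜ S A B) : IsSplit G S A B where
  union_eq := h.union_eq
  disjoint := h.disjoint
  left_nonempty := h.left_nonempty
  right_nonempty := h.right_nonempty
  uniform := by
    have hne : ∀ x ∈ A, ∀ y ∈ B, x ≠ y := fun x hx y hy hxy =>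
      Set.disjoint_left.1 h.disjoint hx (hxy ▸ hy)
    refine h.uniform.symm.imp (fun h x hx y hy => ?_) fun h x hx y hy hxy => (h x hx y hy).2 hxy
    by_contra hxy
    exact h x hx y hy ⟨hne x hx y hy, hxy⟩

/-- A vertex that has neighbours in both sides of an edgeless split and a non-neighbour in the
left side still leaves a split. -/
theorem exists_isSplit_insert_of_nonadj (hG : IsCograph G) {S A B : Set V} {v w x : V}
    (hv : v ∉ S) (hAB : A ∪ B = S) (hn : ∀ x ∈ A, ∀ y ∈ B, ¬ G.Adj x y)
    (hw : w ∈ B) (hvw : G.Adj v w) (hx : x ∈ A) (hvx : ¬ G.Adj v x) :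
    ∃ A' B', IsSplit G (insert v S) A' B' := by
  have hA : A ⊆ S := hAB ▸ Set.subset_union_left
  refine ⟨{x ∈ A | ¬ G.Adj v x}, insert v S \ {x ∈ A | ¬ G.Adj v x}, ?_, ?_, ⟨x, hx, hvx⟩,
    ⟨v, by simp, fun h => hv (hA h.1)⟩, Or.inr ?_⟩
  · exact Set.union_sdiff_cancel fun y hy => Or.inr (hA hy.1)
  · exact Set.disjoint_sdiff_right
  · rintro z ⟨hz, hvz⟩ y ⟨rfl | hy, hy'⟩ hzy
    · exact hvz hzy.symm
    · rw [← hAB] at hy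
      rcases hy with hy | hy
      · have hvy : G.Adj v y := by
          by_contra hvy
          exact hy' ⟨hy, hvy⟩
        rcases isCograph_iff.1 hG w v y z hvw.symm hvy hzy.symm with h | h | h
        · exact hn y hy w hw h.symm
        · exact hn z hz w hw h.symm
        · exact hvz h
      · exact hn z hz y hy hzy

theorem exists_isSplit_insert (hG : IsCograph G) {S A B : Set V} {v : V} (hv : v ∉ S)
    (h : IsSplit G S A B) (hn : ∀ x ∈ A, ∀ y ∈ B, ¬ G.Adj x y) :
    ∃ A' B', IsSplit G (insert v S) A' B' := by
  have hvA : v ∉ A := fun hA => hv (h.union_eq ▸ Or.inl hA)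
  have hvB : v ∉ B := fun hB => hv (h.union_eq ▸ Or.inr hB)
  by_cases hA : ∀ x ∈ A, ¬ G.Adj v x
  · refine ⟨A, insert v B, ?_, ?_, h.left_nonempty, ⟨v, by simp⟩, Or.inr ?_⟩
    · rw [Set.union_insert, h.union_eq]
    · exact Set.disjoint_insert_right.2 ⟨hvA, h.disjoint⟩
    · rintro x hx y (rfl | hy)
      · exact fun hxy => hA x hx hxy.symm
      · exact hn x hx y hy
  by_cases hB : ∀ x ∈ B, ¬ G.Adj v x
  · refine ⟨insert v A, B, ?_, ?_, ⟨v, by simp⟩, h.right_nonempty, Or.inr ?_⟩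
    · rw [Set.insert_union, h.union_eq]
    · exact Set.disjoint_insert_left.2 ⟨hvB, h.disjoint⟩
    · rintro x (rfl | hx) y hy
      · exact hB y hy
      · exact hn x hx y hy
  push Not at hA hB
  obtain ⟨a, haA, hva⟩ := hA
  obtain ⟨b, hbB, hvb⟩ := hB
  by_cases hall : ∀ x ∈ S, G.Adj v x
  · refine ⟨{v}, S, by rw [Set.singleton_union], Set.disjoint_singleton_left.2 hv, ⟨v, rfl⟩,
      ⟨a, h.union_eq ▸ Or.inl haA⟩, Or.inl ?_⟩
    rintro x rfl y hy
    exact hall y hy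
  push Not at hall
  obtain ⟨x, hx, hvx⟩ := hall
  rw [← h.union_eq] at hx
  rcases hx with hx | hx
  · exact exists_isSplit_insert_of_nonadj hG hv h.union_eq hn hbB hvb hx hvx
  · exact exists_isSplit_insert_of_nonadj hG hv h.symm.union_eq
      (fun x hx y hy hxy => hn y hy x hx hxy.symm) haA hva hx hvx

/-- Every cograph with at least two vertices is a disjoint union or a join. -/
theorem exists_isSplit (hG : IsCograph G) (S : Finset V) (hS : 2 ≤ S.card) :
    ∃ A B, IsSplit G (S : Set V) A B := by
  classical
  induction S using Finset.induction_on with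
  | empty => simp at hS
  | insert v S hv ih =>
    rw [Finset.coe_insert]
    rw [Finset.card_insert_of_notMem hv] at hS
    rcases Nat.lt_or_ge S.card 2 with h1 | h2
    · obtain ⟨u, rfl⟩ := Finset.card_eq_one.1 (show S.card = 1 by omega)
      have hvu : v ≠ u := by simpa using hv
      refine ⟨{v}, {u}, by simp [Set.pair_comm], by simpa using hvu, by simp, by simp, ?_⟩
      simpa using em (G.Adj v u)
    · obtain ⟨A, B, h⟩ := ih h2
      have hv' : v ∉ (S : Set V) := by simpa using hv
      rcases h.uniform with hj | hn
      · have hc : IsSplit Gᶜ (S : Set V) A B := IsSplit.of_compl (by rwa [compl_compl])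
        obtain ⟨A', B', h'⟩ := exists_isSplit_insert hG.compl hv' hc
          fun x hx y hy hxy => hxy.2 (hj x hx y hy)
        exact ⟨A', B', h'.of_compl⟩
      · exact exists_isSplit_insert hG hv' h hn

/-- A cograph has a module that contains between a third and two thirds of its vertices. -/
theorem exists_balanced_module (hG : IsCograph G) (S : Finset V) (hS : 2 ≤ S.card) :
    ∃ M ⊆ S, S.card ≤ 3 * M.card ∧ 3 * M.card ≤ 2 * S.card ∧
      ∀ x ∈ S, x ∉ M → (∀ y ∈ M, G.Adj x y) ∨ ∀ y ∈ M, ¬ G.Adj x y := by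
  classical
  obtain ⟨M, hM, hmin⟩ := Finset.exists_min_image
    (S.powerset.filter fun M => 2 * S.card < 3 * M.card ∧
      ∀ x ∈ S, x ∉ M → (∀ y ∈ M, G.Adj x y) ∨ ∀ y ∈ M, ¬ G.Adj x y) Finset.card
    ⟨S, by
      simpa using ⟨by omega, fun x hx hx' => absurd hx hx'⟩⟩
  simp only [Finset.mem_filter, Finset.mem_powerset] at hM hmin
  obtain ⟨hMS, hM2, hMmod⟩ := hM
  obtain ⟨A, B, h⟩ : ∃ A B : Finset V, IsSplit G (M : Set V) A B := by
    obtain ⟨A, B, h⟩ := exists_isSplit hG M (by omega)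
    have hA : A.Finite := M.finite_toSet.subset (h.union_eq ▸ Set.subset_union_left)
    have hB : B.Finite := M.finite_toSet.subset (h.union_eq ▸ Set.subset_union_right)
    exact ⟨hA.toFinset, hB.toFinset, by simpa using h⟩
  wlog hBA : B.card ≤ A.card generalizing A B
  · exact this B A h.symm (by omega)
  have hU : A ∪ B = M := by exact_mod_cast h.union_eq
  have hcard : A.card + B.card = M.card := by
    rw [← hU, Finset.card_union_of_disjoint (by exact_mod_cast h.disjoint)]
  have hBpos : 0 < B.card := Finset.card_pos.2 (by exact_mod_cast h.right_nonempty)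
  have hAM : A ⊆ M := hU ▸ Finset.subset_union_left
  have hAmod : ∀ x ∈ S, x ∉ A → (∀ y ∈ A, G.Adj x y) ∨ ∀ y ∈ A, ¬ G.Adj x y := by
    intro x hx hxA
    by_cases hxM : x ∈ M
    · have hxB : x ∈ B := by
        rw [← hU, Finset.mem_union] at hxM
        tauto
      exact h.symm.uniform.imp (fun h => h x hxB) fun h => h x hxB
    · exact (hMmod x hx hxM).imp (fun h y hy => h y (hAM hy)) fun h y hy => h y (hAM hy)
  refine ⟨A, hAM.trans hMS, by omega, ?_, hAmod⟩
  by_contra hlt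
  have := hmin A ⟨hAM.trans hMS, by omega, hAmod⟩
  omega

/-- The adjacency of two nodes as read off from their labels. A label consists of two lists of bits:
at each level of the decomposition, the first tells on which side of a module the node lies, and the
second whether a node outside of the module is joined to it. -/
def labelAdj (a b a' b' : List Bool) : Bool :=
  (List.range a.length).foldr (fun i acc => bif a.getD i false == a'.getD i false then acc
    else bif a.getD i false then b'.getD i false else b.getD i false) false

theorem labelAdj_cons (s t s' t' : Bool) (a b a' b' : List Bool) :
    labelAdj (s :: a) (t :: b) (s' :: a') (t' :: b') =
      bif s == s' then labelAdj a b a' b' else bif s then t' else t := by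
  simp [labelAdj, List.range_succ_eq_map, List.foldr_map]

theorem exists_labels (hG : IsCograph G) (k : ℕ) (S : Finset V) (hS : 2 ^ k * S.card ≤ 3 ^ k) :
    ∃ a b : V → List Bool, (∀ v, (a v).length ≤ k ∧ (b v).length ≤ k) ∧
      ∀ u ∈ S, ∀ v ∈ S, u ≠ v → (labelAdj (a u) (b u) (a v) (b v) = true ↔ G.Adj u v) := by
  classical
  induction k generalizing S with
  | zero =>
    refine ⟨fun _ => [], fun _ => [], by simp, fun u hu v hv huv => ?_⟩
    exact absurd (Finset.card_le_one.1 (by simpa using hS) u hu v hv) huv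
  | succ k ih =>
    rcases Nat.lt_or_ge S.card 2 with h1 | h2
    · refine ⟨fun _ => [], fun _ => [], by simp, fun u hu v hv huv => ?_⟩
      exact absurd (Finset.card_le_one.1 (by omega) u hu v hv) huv
    obtain ⟨M, hMS, hM1, hM2, hmod⟩ := exists_balanced_module hG S h2
    have hsmall : ∀ T : Finset V, 3 * T.card ≤ 2 * S.card → 2 ^ k * T.card ≤ 3 ^ k := by
      intro T hT
      have := Nat.mul_le_mul_left (2 ^ k) hT
      rw [pow_succ, pow_succ] at hS
      nlinarith
    have hdiff := Finset.card_sdiff_add_card_eq_card hMS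
    obtain ⟨a₁, b₁, hl₁, h₁⟩ := ih M (hsmall M hM2)
    obtain ⟨a₂, b₂, hl₂, h₂⟩ := ih (S \ M) (hsmall _ (by omega))
    refine ⟨fun v => if v ∈ M then true :: a₁ v else false :: a₂ v,
      fun v => if v ∈ M then false :: b₁ v else decide (∃ y ∈ M, G.Adj v y) :: b₂ v, ?_, ?_⟩
    · intro v
      have := hl₁ v
      have := hl₂ v
      dsimp only
      split_ifs <;> simp <;> omega
    · have hjoin : ∀ u ∈ S, u ∉ M → ∀ v ∈ M, ((∃ y ∈ M, G.Adj u y) ↔ G.Adj u v) := by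
        intro u hu huM v hv
        refine ⟨fun ⟨y, hy, huy⟩ => ?_, fun huv => ⟨v, hv, huv⟩⟩
        rcases hmod u hu huM with h | h
        · exact h v hv
        · exact absurd huy (h y hy)
      intro u hu v hv huv
      by_cases huM : u ∈ M <;> by_cases hvM : v ∈ M <;>
        simp only [huM, hvM, if_true, if_false, labelAdj_cons]
      · simpa using h₁ u huM v hvM huv
      · simpa [G.adj_comm u v] using hjoin v hv hvM u huM
      · simpa using hjoin u hu huM v hvM
      · simpa using h₂ u (by simp [hu, huM]) v (by simp [hv, hvM]) huv

/-- A connected cograph with at least two vertices is a join. -/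
theorem exists_join [Fintype V] (hG : IsCograph G) (hc : G.Connected) (hV : 2 ≤ Fintype.card V) :
    ∃ A B : Finset V, (∀ v, v ∈ A ∨ v ∈ B) ∧ (∀ u ∈ A, ∀ v ∈ B, G.Adj u v) ∧
      B.Nonempty ∧ B.card ≤ A.card := by
  classical
  obtain ⟨A, B, h⟩ : ∃ A B : Finset V, IsSplit G ((Finset.univ : Finset V) : Set V) A B := by
    obtain ⟨A, B, h⟩ := exists_isSplit hG Finset.univ (by simpa using hV)
    exact ⟨A.toFinset, B.toFinset, by simpa using h⟩
  wlog hBA : B.card ≤ A.card generalizing A B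
  · exact this B A h.symm (by omega)
  have hU : ∀ v, v ∈ A ∨ v ∈ B := fun v => by
    have : v ∈ (A : Set V) ∪ B := h.union_eq ▸ by simp
    simpa using this
  refine ⟨A, B, hU, h.uniform.resolve_right fun hn => ?_, by exact_mod_cast h.right_nonempty, hBA⟩
  obtain ⟨u, hu⟩ := h.left_nonempty
  obtain ⟨v, hv⟩ := h.right_nonempty
  have hA : ∀ w, G.Reachable u w → w ∈ A := by
    rintro w ⟨p⟩
    have hu' : u ∈ A := hu
    clear hu
    induction p with
    | nil => exact hu'
    | cons hxy _ ih =>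
      exact ih ((hU _).resolve_right fun hy => hn _ hu' _ hy hxy)
  exact Set.disjoint_left.1 h.disjoint (hA v (hc.preconnected u v)) hv

end Cographs

section Codes

/-- The bit string that stores a list of bit strings. -/
def encodeFields (fs : List (List Bool)) : List Bool :=
  fs.flatMap fun f => f.flatMap (fun b => [true, b]) ++ [false, false]

/-- One step of decoding from the right; the first component of the state is the second bit of an
incomplete pair. -/
def decodeStep (x : Bool) (s : Option Bool × List (List Bool)) : Option Bool × List (List Bool) :=
  s.1.casesOn (some x, s.2) fun b =>
    (none, bif x then (b :: s.2.headI) :: s.2.tail else [] :: s.2)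

/-- The list of bit strings that is stored in a bit string. -/
def decodeFields (l : List Bool) : List (List Bool) :=
  (l.foldr decodeStep (none, [])).2

theorem decodeFields_encodeFields (fs : List (List Bool)) :
    decodeFields (encodeFields fs) = fs := by
  have key : ∀ (f g : List Bool) (gs : List (List Bool)),
      (f.flatMap fun b => [true, b]).foldr decodeStep (none, g :: gs) = (none, (f ++ g) :: gs) := by
    intro f g gs
    induction f with
    | nil => rfl
    | cons b f ih => simp [decodeStep, ih]
  have : (encodeFields fs).foldr decodeStep (none, []) = (none, fs) := by
    induction fs with
    | nil => rfl
    | cons f fs ih =>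
      rw [encodeFields, List.flatMap_cons, List.foldr_append, ← encodeFields, ih,
        List.foldr_append]
      simpa [decodeStep] using key f [] fs
  rw [decodeFields, this]

theorem length_encodeFields (fs : List (List Bool)) :
    (encodeFields fs).length = (fs.map fun f => 2 * f.length + 2).sum := by
  simp [encodeFields, List.length_flatMap, mul_comm]

/-- The `w` lowest binary digits of `m`, lowest first. -/
def natBits (w m : ℕ) : List Bool :=
  (List.range w).map fun i => m / 2 ^ i % 2 == 1

/-- The number with the given binary digits. -/
def bitsVal (l : List Bool) : ℕ :=
  l.foldr (fun b acc => 2 * acc + bif b then 1 else 0) 0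

@[simp]
theorem length_natBits (w m : ℕ) : (natBits w m).length = w := by
  simp [natBits]

theorem bitsVal_natBits {w m : ℕ} (h : m < 2 ^ w) : bitsVal (natBits w m) = m := by
  induction w generalizing m with
  | zero => simp [natBits, bitsVal] at h ⊢; omega
  | succ w ih =>
    have hcons : natBits (w + 1) m = (m % 2 == 1) :: natBits w (m / 2) := by
      simp [natBits, List.range_succ_eq_map, Function.comp_def, pow_succ', Nat.div_div_eq_div_mul]
    rw [hcons, bitsVal, List.foldr_cons, ← bitsVal, ih (by rw [pow_succ] at h; omega)]
    rcases Nat.mod_two_eq_zero_or_one m with h0 | h0 <;> simp [h0] <;> omega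

/-- The elements of a list in a canonical order, without repetitions. -/
def canonicalList {α : Type*} [Primcodable α] [Inhabited α] (l : List α) : List α :=
  ((List.range ((l.map Encodable.encode).sum + 1)).filter
    fun i => l.any fun a => Encodable.encode a == i).map
      fun i => (Encodable.decode (α := α) i).getD default

variable {α : Type*} [Primcodable α] [Inhabited α]

theorem mem_canonicalList {l : List α} {a : α} : a ∈ canonicalList l ↔ a ∈ l := by
  simp only [canonicalList, List.mem_map, List.mem_filter, List.mem_range, List.any_eq_true,
    beq_iff_eq]
  constructor
  · rintro ⟨i, ⟨-, b, hb, rfl⟩, rfl⟩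
    simpa using hb
  · intro ha
    refine ⟨Encodable.encode a, ⟨?_, a, ha, rfl⟩, by simp⟩
    exact Nat.lt_succ_of_le (List.le_sum_of_mem (List.mem_map_of_mem ha))

theorem nodup_canonicalList (l : List α) : (canonicalList l).Nodup := by
  refine List.Nodup.map_on ?_ (List.nodup_range.filter _)
  intro i hi j hj hij
  simp only [List.mem_filter, List.any_eq_true, beq_iff_eq] at hi hj
  obtain ⟨-, a, -, rfl⟩ := hi
  obtain ⟨-, b, -, rfl⟩ := hj
  simpa using hij

theorem _root_.List.Perm.canonicalList_eq {l l' : List α} (h : l.Perm l') :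
    canonicalList l = canonicalList l' := by
  have h1 : (l.map Encodable.encode).sum = (l'.map Encodable.encode).sum := (h.map _).sum_eq
  have h2 : ∀ i, (l.any fun a => Encodable.encode a == i) =
      l'.any fun a => Encodable.encode a == i := fun i => by
    rw [Bool.eq_iff_iff]
    simp [h.mem_iff]
  simp only [canonicalList, h1, h2]

end Codes

section Computability

variable {α β : Type*} [Primcodable α] [Primcodable β]

theorem primrec_list_any {f : α → List β} {g : α → β → Bool} (hf : Primrec f) (hg : Primrec₂ g) :
    Primrec fun x => (f x).any (g x) := by
  refine (Primrec.list_foldr (h := fun x s => g x s.1 || s.2) hf (Primrec.const false) ?_).of_eq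
    fun x => ?_
  · exact Primrec.or.comp
      (hg.comp Primrec.fst (Primrec.fst.comp Primrec.snd)) (Primrec.snd.comp Primrec.snd)
  · induction f x with
    | nil => rfl
    | cons b l ih => simp [ih]

theorem primrec_list_all {f : α → List β} {g : α → β → Bool} (hf : Primrec f) (hg : Primrec₂ g) :
    Primrec fun x => (f x).all (g x) := by
  refine (Primrec.list_foldr (h := fun x s => g x s.1 && s.2) hf (Primrec.const true) ?_).of_eq
    fun x => ?_
  · exact Primrec.and.comp
      (hg.comp Primrec.fst (Primrec.fst.comp Primrec.snd)) (Primrec.snd.comp Primrec.snd)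
  · induction f x with
    | nil => rfl
    | cons b l ih => simp [ih]

theorem primrec_list_filter {f : α → List β} {g : α → β → Bool} (hf : Primrec f)
    (hg : Primrec₂ g) : Primrec fun x => (f x).filter (g x) := by
  refine (Primrec.list_flatMap (g := fun x b => bif g x b then [b] else []) hf ?_).of_eq
    fun x => ?_
  · exact Primrec.cond hg (Primrec.list_cons.comp Primrec.snd (Primrec.const []))
      (Primrec.const [])
  · induction f x with
    | nil => rfl
    | cons b l ih => cases h : g x b <;> simp [ih, h]

theorem primrec_beq [BEq β] [LawfulBEq β] {f g : α → β} (hf : Primrec f) (hg : Primrec g) :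
    Primrec fun x => f x == g x := by
  classical
  exact (Primrec.eq.comp hf hg).decide.of_eq fun x => by rw [Bool.eq_iff_iff]; simp

theorem primrec_two_pow : Primrec fun n : ℕ => 2 ^ n := by
  refine (Primrec.nat_rec₁ (f := fun _ m => 2 * m) 1
    (Primrec.nat_mul.comp (Primrec.const 2) Primrec.snd)).of_eq fun n => ?_
  induction n with
  | zero => rfl
  | succ n ih => rw [pow_succ', ← ih]

theorem primrec_encodeFields : Primrec encodeFields := by
  refine Primrec.list_flatMap Primrec.id (Primrec.list_append.comp
    (Primrec.list_flatMap Primrec.snd ?_) (Primrec.const [false, false]))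
  exact Primrec.list_cons.comp (Primrec.const true)
    (Primrec.list_cons.comp Primrec.snd (Primrec.const []))

theorem primrec_decodeStep : Primrec₂ decodeStep := by
  have hs : Primrec fun y : (Bool × (Option Bool × List (List Bool))) × Bool => y.1.2.2 :=
    Primrec.snd.comp (Primrec.snd.comp Primrec.fst)
  have h : Primrec fun y : Bool × (Option Bool × List (List Bool)) => decodeStep y.1 y.2 := by
    refine Primrec.option_casesOn (Primrec.fst.comp Primrec.snd)
      (Primrec.pair (Primrec.option_some.comp Primrec.fst) (Primrec.snd.comp Primrec.snd)) ?_
    exact Primrec.pair (Primrec.const none) (Primrec.cond (Primrec.fst.comp Primrec.fst)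
      (Primrec.list_cons.comp (Primrec.list_cons.comp Primrec.snd (Primrec.list_headI.comp hs))
        (Primrec.list_tail.comp hs))
      (Primrec.list_cons.comp (Primrec.const []) hs))
  exact h

theorem primrec_decodeFields : Primrec decodeFields := by
  refine Primrec.snd.comp (Primrec.list_foldr (h := fun _ s => decodeStep s.1 s.2) Primrec.id
    (Primrec.const (none, [])) ?_)
  exact primrec_decodeStep.comp (Primrec.fst.comp Primrec.snd) (Primrec.snd.comp Primrec.snd)

theorem primrec_natBits : Primrec₂ natBits := by
  refine Primrec.list_map (Primrec.list_range.comp Primrec.fst) ?_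
  exact primrec_beq (Primrec.nat_mod.comp (Primrec.nat_div.comp (Primrec.snd.comp Primrec.fst)
    (primrec_two_pow.comp Primrec.snd)) (Primrec.const 2)) (Primrec.const 1)

theorem primrec_bitsVal : Primrec bitsVal := by
  refine Primrec.list_foldr (h := fun _ s => 2 * s.2 + bif s.1 then 1 else 0) Primrec.id
    (Primrec.const 0) ?_
  exact Primrec.nat_add.comp
    (Primrec.nat_mul.comp (Primrec.const 2) (Primrec.snd.comp Primrec.snd))
    (Primrec.cond (Primrec.fst.comp Primrec.snd) (Primrec.const 1) (Primrec.const 0))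

theorem primrec_canonicalList [Inhabited α] : Primrec (canonicalList (α := α)) := by
  have hsum : Primrec fun l : List α => (l.map Encodable.encode).sum := by
    refine (Primrec.list_foldr (h := fun _ s => Encodable.encode s.1 + s.2) Primrec.id
      (Primrec.const 0) ?_).of_eq fun l => ?_
    · exact Primrec.nat_add.comp (Primrec.encode.comp (Primrec.fst.comp Primrec.snd))
        (Primrec.snd.comp Primrec.snd)
    · induction l with
      | nil => rfl
      | cons a l ih => simpa using ih
  refine Primrec.list_map (primrec_list_filter
    (Primrec.list_range.comp (Primrec.succ.comp hsum)) (primrec_list_any Primrec.fst ?_)) ?_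
  · exact primrec_beq (Primrec.encode.comp Primrec.snd) (Primrec.snd.comp Primrec.fst)
  · exact Primrec.option_getD_default.comp (Primrec.decode.comp Primrec.snd)

theorem primrec_labelAdj {a b a' b' : α → List Bool} (ha : Primrec a) (hb : Primrec b)
    (ha' : Primrec a') (hb' : Primrec b') :
    Primrec fun x => labelAdj (a x) (b x) (a' x) (b' x) := by
  have get : ∀ {l : α → List Bool}, Primrec l →
      Primrec fun y : α × (ℕ × Bool) => (l y.1).getD y.2.1 false := fun h =>
    (Primrec.list_getD false).comp (h.comp Primrec.fst) (Primrec.fst.comp Primrec.snd)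
  refine Primrec.list_foldr
    (h := fun x s => bif (a x).getD s.1 false == (a' x).getD s.1 false then s.2
      else bif (a x).getD s.1 false then (b' x).getD s.1 false else (b x).getD s.1 false)
    (Primrec.list_range.comp (Primrec.list_length.comp ha)) (Primrec.const false) ?_
  exact Primrec.cond (primrec_beq (get ha) (get ha')) (Primrec.snd.comp Primrec.snd)
    (Primrec.cond (get ha) (get hb') (get hb))

end Computability

section Records

/-- What is announced about a node: the digits of its identifier, its input label, the two lists of
bits of its adjacency label, and the digits of its degree. -/
abbrev Record := List (List Bool)

/-- Adjacency of two nodes as read off from their records. -/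
def Record.adj (x y : Record) : Bool :=
  labelAdj (x.getD 2 []) (x.getD 3 []) (y.getD 2 []) (y.getD 3 []) && !(x == y)

/-- The graph that is described by the records in `S` is a cograph. -/
def cographCheck (S : List Record) : Bool :=
  S.all fun x => S.all fun y => S.all fun z => S.all fun t =>
    !(x.adj y && (y.adj z && z.adj t)) || (x.adj z || (x.adj t || y.adj t))

/-- The announced degrees are those of the graph that is described by the records in `S`. -/
def degreeCheck (S : List Record) : Bool :=
  S.all fun x => bitsVal (x.getD 4 []) == (S.filter x.adj).length

/-- The description of the configuration that consists of the nodes with records in `S`. -/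
def recordCode (S : List Record) : List (ℕ × List Bool × List Bool) :=
  S.map fun x => (bitsVal (x.getD 0 []), x.getD 1 [], S.map x.adj)

/-- The record `R v` describes the node `v` of `C`. -/
structure IsRecordSystem (C : NetworkConfig) (R : Fin C.n → Record) : Prop where
  ident_eq : ∀ v, bitsVal ((R v).getD 0 []) = C.ident v
  input_eq : ∀ v, (R v).getD 1 [] = C.input v
  adj_iff : ∀ v w, (R v).adj (R w) = true ↔ C.graph.Adj v w

theorem cographCheck_iff {C : NetworkConfig} {R : Fin C.n → Record} (hR : IsRecordSystem C R)
    {S : List Record} (hS : ∀ x, x ∈ S ↔ ∃ v, R v = x) :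
    cographCheck S = true ↔ IsCograph C.graph := by
  rw [isCograph_iff]
  simp only [cographCheck, List.all_eq_true, hS, forall_exists_index, forall_apply_eq_imp_iff]
  refine forall_congr' fun x => forall_congr' fun y => forall_congr' fun z =>
    forall_congr' fun t => ?_
  simp only [Bool.or_eq_true, Bool.not_eq_true', ← Bool.not_eq_true, Bool.and_eq_true, hR.adj_iff]
  tauto

theorem mem_iff_recordCode {L : Set NetworkConfig} (hL : IsDistributedLanguage L)
    {p : List (ℕ × List Bool × List Bool) → Prop} (hp : ∀ C : NetworkConfig, C ∈ L ↔ p C.code)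
    {C : NetworkConfig} {R : Fin C.n → Record} (hR : IsRecordSystem C R)
    (hinj : Function.Injective R) {S : List Record} (hnd : S.Nodup)
    (hS : ∀ x, x ∈ S ↔ ∃ v, R v = x) : C ∈ L ↔ p (recordCode S) := by
  have hg : ∀ i : Fin S.length, ∃ v, R v = S.get i := fun i => (hS _).1 (S.get_mem i)
  choose g hg using hg
  have hbij : Function.Bijective g := by
    refine ⟨fun i j hij => (List.nodup_iff_injective_get.1 hnd) ?_, fun v => ?_⟩
    · rw [← hg, ← hg, hij]
    · obtain ⟨i, hi⟩ := List.get_of_mem ((hS (R v)).2 ⟨v, rfl⟩)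
      exact ⟨i, hinj (by rw [hg, hi])⟩
  let e : Fin S.length ≃ Fin C.n := Equiv.ofBijective g hbij
  let D : NetworkConfig := ⟨S.length, C.graph.comap e, C.ident ∘ e, C.input ∘ e⟩
  have hDC : D.Isomorphic C := ⟨SimpleGraph.Iso.comap e C.graph, fun v => rfl, fun v => rfl⟩
  have hCD : C.Isomorphic D := by
    refine ⟨(SimpleGraph.Iso.comap e C.graph).symm, fun v => ?_, fun v => ?_⟩
    · exact congrArg C.ident (e.apply_symm_apply v)
    · exact congrArg C.input (e.apply_symm_apply v)
  have hmap : ∀ {β : Type} (F : Record → β), S.map F = List.ofFn fun i => F (S.get i) := by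
    intro β F
    conv_lhs => rw [← List.ofFn_get S, List.map_ofFn]
    rfl
  have hcode : D.code = recordCode S := by
    rw [recordCode, hmap, NetworkConfig.code]
    congr 1
    funext i
    rw [hmap, ← hg, hR.ident_eq, hR.input_eq]
    refine Prod.ext rfl (Prod.ext rfl ?_)
    change List.ofFn _ = List.ofFn _
    congr 1
    funext j
    rw [Bool.eq_iff_iff, ← hg, hR.adj_iff]
    exact @decide_eq_true_iff _ (_)
  rw [← hcode, ← hp]
  exact ⟨hL.iso_invariant C D hCD, hL.iso_invariant D C hDC⟩

end Records

section Protocol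

/-- The message of a node: its identifier, its input label and its certificate, unless the latter
is too long. -/
def nodeMessage (c K : ℕ) (x : LocalView) : List Bool :=
  encodeFields [natBits ((c + 1) * x.2.2.1.length) x.1, x.2.1,
    if x.2.2.2.length ≤ K * x.2.2.1.length then x.2.2.2 else []]

/-- The fields of the certificate that is contained in a message: the digits of the identifier of
the root, the adjacency label, the degree, and the relayed record. -/
def certFields (m : List Bool) : List (List Bool) :=
  decodeFields ((decodeFields m).getD 2 [])

/-- The record of the sender of a message. -/
def ownRecord (m : List Bool) : Record :=
  [(decodeFields m).getD 0 [], (decodeFields m).getD 1 [], (certFields m).getD 1 [],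
    (certFields m).getD 2 [], (certFields m).getD 3 []]

/-- The digits of the identifier of the root, as announced in a message. -/
def rootIdent (m : List Bool) : List Bool :=
  (certFields m).getD 0 []

/-- The record that is relayed in a message. -/
def relayedRecord (m : List Bool) : Record :=
  decodeFields ((certFields m).getD 4 [])

/-- The sender of a message is the announced root. -/
def isRoot (m : List Bool) : Bool :=
  (ownRecord m).getD 0 [] == rootIdent m

/-- The check that every node makes, given its own message and those of its neighbours. -/
def localCheck (m : List Bool) (ms : List (List Bool)) : Bool :=
  (ms.all fun m' => rootIdent m' == rootIdent m) &&
  ((bitsVal ((ownRecord m).getD 4 []) == ms.length) &&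
  ((ms.all fun m' => (ownRecord m).adj (ownRecord m')) &&
  ((relayedRecord m == ownRecord m ||
    ((ms.any fun m' => ownRecord m' == relayedRecord m) && ms.any isRoot)) &&
  (isRoot m || (ms.any isRoot || ms.any fun m' => relayedRecord m' == ownRecord m)))))

/-- All records that a node gets to know. -/
def knownRecords (m : List Bool) (ms : List (List Bool)) : List Record :=
  canonicalList (ownRecord m :: (ms.map ownRecord ++ ms.map relayedRecord))

/-- The verdict of a node, given its own message and those of its neighbours; `f` decides the
language on codes of configurations. -/
def nodeVerdict (f : List (ℕ × List Bool × List Bool) → Bool) (m : List Bool)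
    (ms : List (List Bool)) : Bool :=
  localCheck m ms && (!isRoot m ||
    (degreeCheck (knownRecords m ms) && (cographCheck (knownRecords m ms) &&
      f (recordCode (knownRecords m ms)))))

theorem _root_.List.Perm.nodeVerdict_eq (f : List (ℕ × List Bool × List Bool) → Bool)
    (m : List Bool) {ms ms' : List (List Bool)} (h : ms.Perm ms') :
    nodeVerdict f m ms = nodeVerdict f m ms' := by
  have hk : knownRecords m ms = knownRecords m ms' :=
    (((h.map ownRecord).append (h.map relayedRecord)).cons _).canonicalList_eq
  simp only [nodeVerdict, localCheck, hk, h.all_eq, h.any_eq, h.length_eq]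

end Protocol

section ProtocolComputability

variable {α : Type*} [Primcodable α]

theorem primrec_field {β : Type*} [Primcodable β] {f : α → List (List β)} (hf : Primrec f) (i : ℕ) :
    Primrec fun x => (f x).getD i [] :=
  (Primrec.list_getD []).comp hf (Primrec.const i)

theorem primrec_list_cons {β : Type*} [Primcodable β] {f : α → β} {g : α → List β}
    (hf : Primrec f) (hg : Primrec g) : Primrec fun x => f x :: g x :=
  Primrec.list_cons.comp hf hg

theorem primrec_recordAdj : Primrec₂ Record.adj := by
  refine Primrec.and.comp (primrec_labelAdj (primrec_field Primrec.fst 2)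
    (primrec_field Primrec.fst 3) (primrec_field Primrec.snd 2) (primrec_field Primrec.snd 3)) ?_
  exact Primrec.not.comp (primrec_beq Primrec.fst Primrec.snd)

theorem primrec_cographCheck : Primrec cographCheck := by
  refine primrec_list_all Primrec.id (primrec_list_all Primrec.fst (primrec_list_all
    (Primrec.fst.comp Primrec.fst) (primrec_list_all (Primrec.fst.comp
      (Primrec.fst.comp Primrec.fst)) ?_)))
  have ht : Primrec fun q : (((List Record × Record) × Record) × Record) × Record => q.2 :=
    Primrec.snd
  have hz : Primrec fun q : (((List Record × Record) × Record) × Record) × Record => q.1.2 :=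
    Primrec.snd.comp Primrec.fst
  have hy : Primrec fun q : (((List Record × Record) × Record) × Record) × Record => q.1.1.2 :=
    Primrec.snd.comp (Primrec.fst.comp Primrec.fst)
  have hx : Primrec fun q : (((List Record × Record) × Record) × Record) × Record => q.1.1.1.2 :=
    Primrec.snd.comp (Primrec.fst.comp (Primrec.fst.comp Primrec.fst))
  exact Primrec.or.comp
    (Primrec.not.comp (Primrec.and.comp (primrec_recordAdj.comp hx hy)
      (Primrec.and.comp (primrec_recordAdj.comp hy hz) (primrec_recordAdj.comp hz ht))))
    (Primrec.or.comp (primrec_recordAdj.comp hx hz)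
      (Primrec.or.comp (primrec_recordAdj.comp hx ht) (primrec_recordAdj.comp hy ht)))

theorem primrec_degreeCheck : Primrec degreeCheck := by
  refine primrec_list_all Primrec.id ?_
  exact primrec_beq (primrec_bitsVal.comp (primrec_field Primrec.snd 4))
    (Primrec.list_length.comp (primrec_list_filter Primrec.fst
      (primrec_recordAdj.comp (Primrec.snd.comp Primrec.fst) Primrec.snd)))

theorem primrec_recordCode : Primrec recordCode := by
  refine Primrec.list_map Primrec.id ?_
  exact Primrec.pair (primrec_bitsVal.comp (primrec_field Primrec.snd 0))
    (Primrec.pair (primrec_field Primrec.snd 1) (Primrec.list_map Primrec.fst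
      (primrec_recordAdj.comp (Primrec.snd.comp Primrec.fst) Primrec.snd)))

theorem primrec_nodeMessage (c K : ℕ) : Primrec (nodeMessage c K) := by
  have hr : Primrec fun x : LocalView => x.2.2.1.length :=
    Primrec.list_length.comp (Primrec.fst.comp (Primrec.snd.comp Primrec.snd))
  have hcert : Primrec fun x : LocalView => x.2.2.2 :=
    Primrec.snd.comp (Primrec.snd.comp Primrec.snd)
  refine primrec_encodeFields.comp (primrec_list_cons ?_ (primrec_list_cons ?_
    (primrec_list_cons ?_ (Primrec.const []))))
  · exact primrec_natBits.comp (Primrec.nat_mul.comp (Primrec.const (c + 1)) hr) Primrec.fst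
  · exact Primrec.fst.comp Primrec.snd
  · exact Primrec.ite (Primrec.nat_le.comp (Primrec.list_length.comp hcert)
      (Primrec.nat_mul.comp (Primrec.const K) hr)) hcert (Primrec.const [])

theorem primrec_certFields : Primrec certFields :=
  primrec_decodeFields.comp (primrec_field primrec_decodeFields 2)

theorem primrec_ownRecord : Primrec ownRecord :=
  primrec_list_cons (primrec_field primrec_decodeFields 0)
    (primrec_list_cons (primrec_field primrec_decodeFields 1)
      (primrec_list_cons (primrec_field primrec_certFields 1)
        (primrec_list_cons (primrec_field primrec_certFields 2)
          (primrec_list_cons (primrec_field primrec_certFields 3) (Primrec.const [])))))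

theorem primrec_rootIdent : Primrec rootIdent :=
  primrec_field primrec_certFields 0

theorem primrec_relayedRecord : Primrec relayedRecord :=
  primrec_decodeFields.comp (primrec_field primrec_certFields 4)

theorem primrec_isRoot : Primrec isRoot :=
  primrec_beq (primrec_field primrec_ownRecord 0) primrec_rootIdent

theorem primrec_localCheck : Primrec₂ localCheck := by
  have hm : Primrec fun q : (List Bool × List (List Bool)) × List Bool => q.1.1 :=
    Primrec.fst.comp Primrec.fst
  have hm' : Primrec fun q : (List Bool × List (List Bool)) × List Bool => q.2 := Primrec.snd
  have hroot : Primrec fun q : List Bool × List (List Bool) => q.2.any isRoot :=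
    primrec_list_any Primrec.snd (primrec_isRoot.comp hm')
  have h : Primrec fun q : List Bool × List (List Bool) => localCheck q.1 q.2 := by
    refine Primrec.and.comp (primrec_list_all Primrec.snd ?_) (Primrec.and.comp ?_
      (Primrec.and.comp (primrec_list_all Primrec.snd ?_) (Primrec.and.comp
        (Primrec.or.comp ?_ (Primrec.and.comp (primrec_list_any Primrec.snd ?_) hroot))
        (Primrec.or.comp ?_ (Primrec.or.comp hroot (primrec_list_any Primrec.snd ?_))))))
    · exact primrec_beq (primrec_rootIdent.comp hm') (primrec_rootIdent.comp hm)
    · exact primrec_beq (primrec_bitsVal.comp (primrec_field (primrec_ownRecord.comp Primrec.fst) 4))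
        (Primrec.list_length.comp Primrec.snd)
    · exact primrec_recordAdj.comp (primrec_ownRecord.comp hm) (primrec_ownRecord.comp hm')
    · exact primrec_beq (primrec_relayedRecord.comp Primrec.fst)
        (primrec_ownRecord.comp Primrec.fst)
    · exact primrec_beq (primrec_ownRecord.comp hm') (primrec_relayedRecord.comp hm)
    · exact primrec_isRoot.comp Primrec.fst
    · exact primrec_beq (primrec_relayedRecord.comp hm') (primrec_ownRecord.comp hm)
  exact h

theorem primrec_knownRecords : Primrec₂ knownRecords := by
  refine primrec_canonicalList.comp (primrec_list_cons (primrec_ownRecord.comp Primrec.fst)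
    (Primrec.list_append.comp (Primrec.list_map Primrec.snd ?_) (Primrec.list_map Primrec.snd ?_)))
  · exact primrec_ownRecord.comp Primrec.snd
  · exact primrec_relayedRecord.comp Primrec.snd

theorem computable_nodeVerdict {f : List (ℕ × List Bool × List Bool) → Bool} (hf : Computable f) :
    Computable₂ (nodeVerdict f) := by
  have hS : Primrec fun q : List Bool × List (List Bool) => knownRecords q.1 q.2 :=
    primrec_knownRecords
  refine Primrec.and.to_comp.comp primrec_localCheck.to_comp (Primrec.or.to_comp.comp
    (Primrec.not.comp (primrec_isRoot.comp Primrec.fst)).to_comp (Primrec.and.to_comp.comp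
      (primrec_degreeCheck.comp hS).to_comp (Primrec.and.to_comp.comp
        (primrec_cographCheck.comp hS).to_comp (hf.comp (primrec_recordCode.comp hS).to_comp))))

end ProtocolComputability

section Correctness

variable {C : NetworkConfig} {m : Fin C.n → List Bool} {M : Fin C.n → List (List Bool)}

/-- If all nodes accept, then some node knows the records of all nodes, and these describe `C`. -/
theorem sound_of_forall_nodeVerdict {f : List (ℕ × List Bool × List Bool) → Bool}
    (hc : C.graph.Connected) (hinj : Function.Injective C.ident)
    (hmem : ∀ v x, x ∈ M v ↔ ∃ w, C.graph.Adj v w ∧ m w = x)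
    (hlen : ∀ v, (M v).length = Nat.card {w // C.graph.Adj v w})
    (hid : ∀ v, bitsVal ((ownRecord (m v)).getD 0 []) = C.ident v)
    (hin : ∀ v, (ownRecord (m v)).getD 1 [] = C.input v)
    (hacc : ∀ v, nodeVerdict f (m v) (M v) = true) :
    ∃ S : List Record, S.Nodup ∧ (∀ x, x ∈ S ↔ ∃ v, ownRecord (m v) = x) ∧
      IsRecordSystem C (fun v => ownRecord (m v)) ∧
      cographCheck S = true ∧ f (recordCode S) = true := by
  classical
  have hany : ∀ v (g : List Bool → Bool), (M v).any g = true ↔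
      ∃ w, C.graph.Adj v w ∧ g (m w) = true := by
    intro v g
    simp only [List.any_eq_true, hmem]
    constructor
    · rintro ⟨x, ⟨w, hw, rfl⟩, hx⟩
      exact ⟨w, hw, hx⟩
    · rintro ⟨w, hw, hx⟩
      exact ⟨m w, ⟨w, hw, rfl⟩, hx⟩
  have hall : ∀ v (g : List Bool → Bool), (M v).all g = true ↔
      ∀ w, C.graph.Adj v w → g (m w) = true := by
    intro v g
    simp only [List.all_eq_true, hmem]
    constructor
    · exact fun h w hw => h _ ⟨w, hw, rfl⟩
    · rintro h x ⟨w, hw, rfl⟩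
      exact h w hw
  simp only [nodeVerdict, localCheck, Bool.and_eq_true, Bool.or_eq_true, beq_iff_eq, hany, hall,
    Bool.not_eq_true', ← Bool.not_eq_true] at hacc
  have hrinj : ∀ v w, ownRecord (m v) = ownRecord (m w) → v = w := fun v w h =>
    hinj (by rw [← hid, ← hid, h])
  have hroot : ∀ v w, rootIdent (m v) = rootIdent (m w) := by
    intro v w
    obtain ⟨p⟩ := hc.preconnected v w
    induction p with
    | nil => rfl
    | cons h _ ih => rw [← ih, (hacc _).1.1 _ h]
  have huniq : ∀ v w, isRoot (m v) = true → isRoot (m w) = true → v = w := by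
    intro v w hv hw
    rw [isRoot, beq_iff_eq] at hv hw
    exact hinj (by rw [← hid, ← hid, hv, hw, hroot])
  have hnear : ∀ v, isRoot (m v) = true ∨ (∃ w, C.graph.Adj v w ∧ isRoot (m w) = true) ∨
      ∃ w, C.graph.Adj v w ∧ relayedRecord (m w) = ownRecord (m v) ∧
        ∃ z, C.graph.Adj w z ∧ isRoot (m z) = true := by
    intro v
    rcases (hacc v).1.2.2.2.2 with h | h | ⟨w, hvw, hw⟩
    · exact Or.inl h
    · exact Or.inr (Or.inl h)
    · refine Or.inr (Or.inr ⟨w, hvw, hw, ?_⟩)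
      rcases (hacc w).1.2.2.2.1 with h | h
      · exact absurd (hrinj _ _ (hw.symm.trans h)) hvw.ne
      · exact h.2
  obtain ⟨z, hz⟩ : ∃ z, isRoot (m z) = true := by
    obtain ⟨v⟩ := hc.nonempty
    rcases hnear v with h | ⟨w, -, h⟩ | ⟨w, -, -, z, -, h⟩
    exacts [⟨v, h⟩, ⟨w, h⟩, ⟨z, h⟩]
  have hS : ∀ x, x ∈ knownRecords (m z) (M z) ↔ ∃ v, ownRecord (m v) = x := by
    intro x
    simp only [knownRecords, mem_canonicalList, List.mem_cons, List.mem_append, List.mem_map, hmem]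
    constructor
    · rintro (rfl | ⟨_, ⟨w, -, rfl⟩, rfl⟩ | ⟨_, ⟨w, -, rfl⟩, rfl⟩)
      · exact ⟨z, rfl⟩
      · exact ⟨w, rfl⟩
      · rcases (hacc w).1.2.2.2.1 with h | ⟨⟨u, -, h⟩, -⟩
        exacts [⟨w, h.symm⟩, ⟨u, h⟩]
    · rintro ⟨v, rfl⟩
      rcases hnear v with h | ⟨w, hvw, h⟩ | ⟨w, -, hw, u, hwu, h⟩
      · exact Or.inl (by rw [huniq v z h hz])
      · exact Or.inr (Or.inl ⟨_, ⟨v, by rw [← huniq w z h hz]; exact hvw.symm, rfl⟩, rfl⟩)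
      · exact Or.inr (Or.inr ⟨_, ⟨w, by rw [← huniq u z h hz]; exact hwu.symm, rfl⟩, hw⟩)
  have hnd : (knownRecords (m z) (M z)).Nodup := nodup_canonicalList _
  obtain ⟨hdeg, hcog, hf⟩ := (hacc z).2.resolve_left (not_not_intro hz)
  refine ⟨_, hnd, hS, ⟨hid, hin, fun v w => ?_⟩, hcog, hf⟩
  have hsub : Finset.univ.filter (C.graph.Adj v) ⊆
      Finset.univ.filter fun w => (ownRecord (m v)).adj (ownRecord (m w)) = true := by
    intro w hw
    simp only [Finset.mem_filter, Finset.mem_univ, true_and] at hw ⊢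
    exact (hacc v).1.2.2.1 w hw
  have hcard : (Finset.univ.filter fun w =>
      (ownRecord (m v)).adj (ownRecord (m w)) = true).card ≤
        (Finset.univ.filter (C.graph.Adj v)).card := by
    have h1 := (hacc v).1.2.1
    simp only [degreeCheck, List.all_eq_true, hS, forall_exists_index, forall_apply_eq_imp_iff,
      beq_iff_eq] at hdeg
    rw [hdeg v, hlen, Nat.card_eq_fintype_card, Fintype.card_subtype] at h1
    rw [← h1, ← List.toFinset_card_of_nodup (hnd.filter _)]
    refine Finset.card_le_card_of_injOn (fun w => ownRecord (m w)) (fun w hw => ?_)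
      fun v _ w _ h => hrinj v w h
    simp only [Finset.coe_filter, Finset.mem_univ, true_and, Set.mem_ofPred_eq] at hw
    simp only [List.coe_toFinset, List.mem_filter, Set.mem_ofPred_eq, hS]
    exact ⟨⟨w, rfl⟩, hw⟩
  have heq := Finset.ext_iff.1 (Finset.eq_of_subset_of_card_le hsub hcard) w
  simpa using heq.symm

/-- A root and an assignment of relays through which the root hears of all nodes. -/
theorem exists_relay {V : Type*} [Fintype V] {G : SimpleGraph V} (hG : IsCograph G)
    (hc : G.Connected) : ∃ (z : V) (ρ : V → V),
      (∀ v, ρ v = v ∨ G.Adj v (ρ v) ∧ G.Adj v z) ∧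
      ∀ v, v = z ∨ G.Adj v z ∨ ∃ w, G.Adj v w ∧ ρ w = v := by
  classical
  rcases Nat.lt_or_ge (Fintype.card V) 2 with h1 | h2
  · obtain ⟨z⟩ := hc.nonempty
    have : Subsingleton V := Fintype.card_le_one_iff_subsingleton.1 (by omega)
    exact ⟨z, id, fun v => Or.inl rfl, fun v => Or.inl (Subsingleton.elim _ _)⟩
  obtain ⟨A, B, hU, hadj, ⟨z, hz⟩, hBA⟩ := exists_join hG hc h2
  obtain ⟨g⟩ : Nonempty (B ↪ A) := Function.Embedding.nonempty_of_card_le (by simpa using hBA)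
  refine ⟨z, fun w => if h : ∃ v : B, (g v : V) = w then (h.choose : V) else w, fun w => ?_,
    fun v => ?_⟩
  · by_cases h : ∃ v : B, (g v : V) = w
    · have hw : w ∈ A := by
        obtain ⟨v, rfl⟩ := h
        exact (g v).2
      simp only [h, dif_pos]
      exact Or.inr ⟨hadj w hw _ h.choose.2, hadj w hw z hz⟩
    · simp [h]
  · rcases hU v with hv | hv
    · exact Or.inr (Or.inl (hadj v hv z hz))
    · refine Or.inr (Or.inr ⟨g ⟨v, hv⟩, (hadj _ (g ⟨v, hv⟩).2 v hv).symm, ?_⟩)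
      have h : ∃ u : B, (g u : V) = g ⟨v, hv⟩ := ⟨_, rfl⟩
      simp only [h, dif_pos]
      have := g.injective (Subtype.ext h.choose_spec)
      rw [this]

theorem forall_nodeVerdict_of_relay {f : List (ℕ × List Bool × List Bool) → Bool}
    (hmem : ∀ v x, x ∈ M v ↔ ∃ w, C.graph.Adj v w ∧ m w = x)
    (hlen : ∀ v, (M v).length = Nat.card {w // C.graph.Adj v w})
    (hinj : Function.Injective C.ident) {z : Fin C.n} {ρ : Fin C.n → Fin C.n}
    (hρ : ∀ v, ρ v = v ∨ C.graph.Adj v (ρ v) ∧ C.graph.Adj v z)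
    (hz : ∀ v, v = z ∨ C.graph.Adj v z ∨ ∃ w, C.graph.Adj v w ∧ ρ w = v)
    (hR : IsRecordSystem C fun v => ownRecord (m v))
    (hroot : ∀ v, rootIdent (m v) = (ownRecord (m z)).getD 0 [])
    (hrelay : ∀ v, relayedRecord (m v) = ownRecord (m (ρ v)))
    (hdeg : ∀ v, bitsVal ((ownRecord (m v)).getD 4 []) = Nat.card {w // C.graph.Adj v w})
    (hG : IsCograph C.graph)
    (hf : ∀ S : List Record, S.Nodup → (∀ x, x ∈ S ↔ ∃ v, ownRecord (m v) = x) →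
      f (recordCode S) = true) (v : Fin C.n) : nodeVerdict f (m v) (M v) = true := by
  classical
  have hrinj : ∀ v w, ownRecord (m v) = ownRecord (m w) → v = w := fun v w h =>
    hinj (by rw [← hR.ident_eq, ← hR.ident_eq, h])
  have hisroot : ∀ v, isRoot (m v) = true ↔ v = z := by
    intro v
    rw [isRoot, beq_iff_eq, hroot]
    refine ⟨fun h => hinj ?_, fun h => by rw [h]⟩
    rw [← hR.ident_eq, ← hR.ident_eq, h]
  have hmM : ∀ v w, C.graph.Adj v w → m w ∈ M v := fun v w h => (hmem v _).2 ⟨w, h, rfl⟩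
  have hS : ∀ x, x ∈ knownRecords (m z) (M z) ↔ ∃ v, ownRecord (m v) = x := by
    intro x
    simp only [knownRecords, mem_canonicalList, List.mem_cons, List.mem_append, List.mem_map, hmem]
    constructor
    · rintro (rfl | ⟨_, ⟨w, -, rfl⟩, rfl⟩ | ⟨_, ⟨w, -, rfl⟩, rfl⟩)
      exacts [⟨z, rfl⟩, ⟨w, rfl⟩, ⟨ρ w, (hrelay w).symm⟩]
    · rintro ⟨v, rfl⟩
      rcases hz v with rfl | h | ⟨w, hvw, rfl⟩
      · exact Or.inl rfl
      · exact Or.inr (Or.inl ⟨_, ⟨v, h.symm, rfl⟩, rfl⟩)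
      · rcases hρ w with h | h
        · exact absurd h hvw.ne
        · exact Or.inr (Or.inr ⟨_, ⟨w, h.2.symm, rfl⟩, hrelay w⟩)
  have hnd : (knownRecords (m z) (M z)).Nodup := nodup_canonicalList _
  have hlocal : localCheck (m v) (M v) = true := by
    simp only [localCheck, Bool.and_eq_true, Bool.or_eq_true, beq_iff_eq, List.any_eq_true,
      List.all_eq_true, hisroot, hdeg, hlen, hrelay, true_and]
    refine ⟨?_, ?_, ?_, ?_⟩
    · intro x hx
      obtain ⟨w, -, rfl⟩ := (hmem v x).1 hx
      rw [hroot, hroot]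
    · intro x hx
      obtain ⟨w, hw, rfl⟩ := (hmem v x).1 hx
      exact (hR.adj_iff v w).2 hw
    · rcases hρ v with h | h
      · exact Or.inl (by rw [h])
      · exact Or.inr ⟨⟨_, hmM _ _ h.1, rfl⟩, _, hmM _ _ h.2, (hisroot z).2 rfl⟩
    · rcases hz v with h | h | ⟨w, hw, h⟩
      · exact Or.inl h
      · exact Or.inr (Or.inl ⟨_, hmM _ _ h, (hisroot z).2 rfl⟩)
      · exact Or.inr (Or.inr ⟨_, hmM _ _ hw, by rw [hrelay, h]⟩)
  rw [nodeVerdict, hlocal, Bool.true_and, Bool.or_eq_true]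
  by_cases hv : isRoot (m v) = true
  · obtain rfl := (hisroot v).1 hv
    refine Or.inr ?_
    rw [(cographCheck_iff hR hS).2 hG, hf _ hnd hS, Bool.and_true, Bool.and_true, degreeCheck]
    simp only [List.all_eq_true, hS, forall_exists_index, forall_apply_eq_imp_iff, beq_iff_eq, hdeg]
    intro u
    rw [Nat.card_eq_fintype_card, Fintype.card_subtype,
      ← List.toFinset_card_of_nodup (hnd.filter _)]
    refine Finset.card_bij (fun w _ => ownRecord (m w)) ?_ (fun w _ w' _ h => hrinj w w' h) ?_
    · intro w hw
      simp only [List.mem_toFinset, List.mem_filter, hS]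
      exact ⟨⟨w, rfl⟩, (hR.adj_iff u w).2 (by simpa using hw)⟩
    · intro x hx
      simp only [List.mem_toFinset, List.mem_filter, hS] at hx
      obtain ⟨⟨w, rfl⟩, hw⟩ := hx
      exact ⟨w, by simpa using (hR.adj_iff u w).1 hw, rfl⟩
  · exact Or.inl (by simpa using hv)

end Correctness

section Main

theorem coinProb_eq_one {l : ℕ} {E : (Fin l → Bool) → Prop} (h : ∀ r, E r) : coinProb E = 1 := by
  classical
  simp [coinProb, h]

/-- The verifier for the restriction to cographs of the language decided by `f`. -/
def cographVerifier (c K : ℕ) (f : List (ℕ × List Bool × List Bool) → Bool) (hf : Computable f) :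
    Verifier where
  coinRate := 1
  message := nodeMessage c K
  verdict q := nodeVerdict f (nodeMessage c K q.1) q.2
  message_computable := (primrec_nodeMessage c K).to_comp
  verdict_computable := (computable_nodeVerdict hf).comp
    ((primrec_nodeMessage c K).comp Primrec.fst).to_comp Computable.snd
  verdict_perm _ _ _ h := h.nodeVerdict_eq f _

open Classical in
theorem cographVerifier_acceptsAt {c K : ℕ} {f : List (ℕ × List Bool × List Bool) → Bool}
    {hf : Computable f} {C : NetworkConfig} {l : ℕ} {P : Prover C.n l} {r : Fin l → Bool}
    {m : Fin C.n → List Bool} (hm : ∀ v, m v = nodeMessage c K (C.view r v (P r v))) (v : Fin C.n) :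
    (cographVerifier c K f hf).AcceptsAt C P r v ↔ nodeVerdict f (m v)
      (((List.finRange C.n).filter fun w => decide (C.graph.Adj v w)).map m) = true := by
  obtain rfl := funext hm
  rfl

open Classical in
theorem mem_neighbour_messages {C : NetworkConfig} (m : Fin C.n → List Bool) (v : Fin C.n)
    (x : List Bool) :
    x ∈ ((List.finRange C.n).filter fun w => decide (C.graph.Adj v w)).map m ↔
      ∃ w, C.graph.Adj v w ∧ m w = x := by
  simp

open Classical in
theorem length_neighbour_messages {C : NetworkConfig} (m : Fin C.n → List Bool) (v : Fin C.n) :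
    (((List.finRange C.n).filter fun w => decide (C.graph.Adj v w)).map m).length =
      Nat.card {w // C.graph.Adj v w} := by
  rw [List.length_map, Nat.card_eq_fintype_card, Fintype.card_subtype,
    ← List.toFinset_card_of_nodup ((List.nodup_finRange _).filter _)]
  congr 1
  ext w
  simp

theorem length_view_coins {C : NetworkConfig} {l : ℕ} (r : Fin l → Bool) (v : Fin C.n)
    (cert : List Bool) : (C.view r v cert).2.2.1.length = l := by
  simp [NetworkConfig.view]

theorem NetworkConfig.IsNetwork.ident_lt {c d : ℕ} {C : NetworkConfig} (hC : C.IsNetwork c d)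
    (v : Fin C.n) : C.ident v < 2 ^ ((c + 1) * (Nat.log 2 C.n + 1)) := by
  have hn : C.n ≤ 2 ^ (Nat.log 2 C.n + 1) := (Nat.lt_pow_succ_log_self one_lt_two _).le
  calc C.ident v ≤ C.n ^ c := hC.ident_le v
    _ ≤ (2 ^ (Nat.log 2 C.n + 1)) ^ c := Nat.pow_le_pow_left hn c
    _ = 2 ^ (c * (Nat.log 2 C.n + 1)) := by rw [← pow_mul, mul_comm]
    _ < 2 ^ ((c + 1) * (Nat.log 2 C.n + 1)) := Nat.pow_lt_pow_right one_lt_two (by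
      rw [add_mul]; omega)

theorem length_nodeMessage_le {c d K : ℕ} {x : LocalView} {L : ℕ} (hL : 1 ≤ L)
    (hr : x.2.2.1.length = L) (hx : x.2.1.length ≤ d * L) :
    (nodeMessage c K x).length ≤ (2 * (c + 1 + d + K) + 6) * L := by
  have h : (if x.2.2.2.length ≤ K * x.2.2.1.length then x.2.2.2 else []).length ≤ K * L := by
    split_ifs with h
    · rwa [hr] at h
    · simp
  rw [nodeMessage, length_encodeFields]
  simp only [List.map_cons, List.map_nil, List.sum_cons, List.sum_nil, length_natBits, hr] at h ⊢
  nlinarith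

/-- The honest prover makes all nodes accept. -/
theorem exists_certificates {c d : ℕ} {C : NetworkConfig} (hC : C.IsNetwork c d)
    (hG : IsCograph C.graph) : ∃ cert : Fin C.n → List Bool,
      (∀ v, (cert v).length ≤ (6 * c + 4 * d + 66) * (Nat.log 2 C.n + 1)) ∧
      ∀ (f : List (ℕ × List Bool × List Bool) → Bool) (m : Fin C.n → List Bool)
        (M : Fin C.n → List (List Bool)),
        (∀ v, m v = encodeFields
          [natBits ((c + 1) * (Nat.log 2 C.n + 1)) (C.ident v), C.input v, cert v]) →
        (∀ v x, x ∈ M v ↔ ∃ w, C.graph.Adj v w ∧ m w = x) →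
        (∀ v, (M v).length = Nat.card {w // C.graph.Adj v w}) →
        (∀ (R : Fin C.n → Record) (S : List Record), IsRecordSystem C R → Function.Injective R →
          S.Nodup → (∀ x, x ∈ S ↔ ∃ v, R v = x) → f (recordCode S) = true) →
        ∀ v, nodeVerdict f (m v) (M v) = true := by
  classical
  have hn : C.n < 2 ^ (Nat.log 2 C.n + 1) := Nat.lt_pow_succ_log_self one_lt_two _
  have hident := hC.ident_lt
  have hinput := hC.input_le
  obtain ⟨L, hL⟩ : ∃ L, L = Nat.log 2 C.n + 1 := ⟨_, rfl⟩
  have hL1 : 1 ≤ L := by omega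
  rw [← hL] at hn hident hinput ⊢
  clear hL
  have hcard : 2 ^ (2 * L) * (Finset.univ : Finset (Fin C.n)).card ≤ 3 ^ (2 * L) := by
    rw [Finset.card_univ, Fintype.card_fin]
    calc 2 ^ (2 * L) * C.n ≤ 2 ^ (2 * L) * 2 ^ L := Nat.mul_le_mul_left _ hn.le
      _ = 8 ^ L := by rw [pow_mul, ← mul_pow]; norm_num
      _ ≤ 9 ^ L := Nat.pow_le_pow_left (by norm_num) L
      _ = 3 ^ (2 * L) := by rw [pow_mul]; norm_num
  obtain ⟨a, b, hab, hlab⟩ := exists_labels hG (2 * L) Finset.univ hcard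
  obtain ⟨z, ρ, hρ, hz⟩ := exists_relay hG hC.connected
  have hdeglt : ∀ v, Nat.card {w // C.graph.Adj v w} < 2 ^ L := fun v => by
    refine lt_of_le_of_lt ?_ hn
    simpa using Finite.card_subtype_le (C.graph.Adj v)
  let R : Fin C.n → Record := fun v => [natBits ((c + 1) * L) (C.ident v), C.input v, a v, b v,
    natBits L (Nat.card {w // C.graph.Adj v w})]
  have hRid : ∀ v, bitsVal ((R v).getD 0 []) = C.ident v := fun v => bitsVal_natBits (hident v)
  have hRinj : Function.Injective R := fun v w h =>
    hC.ident_injective (by rw [← hRid, ← hRid, h])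
  have hR : IsRecordSystem C R := by
    refine ⟨hRid, fun v => rfl, fun v w => ?_⟩
    have h : (R v).adj (R w) = (labelAdj (a v) (b v) (a w) (b w) && !(R v == R w)) := rfl
    rw [h, Bool.and_eq_true, Bool.not_eq_true', beq_eq_false_iff_ne, hRinj.ne_iff]
    constructor
    · exact fun h => (hlab v (Finset.mem_univ v) w (Finset.mem_univ w) h.2).1 h.1
    · exact fun h => ⟨(hlab v (Finset.mem_univ v) w (Finset.mem_univ w) h.ne).2 h, h.ne⟩
  refine ⟨fun v => encodeFields [natBits ((c + 1) * L) (C.ident z), a v, b v,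
    natBits L (Nat.card {w // C.graph.Adj v w}), encodeFields (R (ρ v))], fun v => ?_, ?_⟩
  · have h1 := hab v
    have h2 := hab (ρ v)
    have h3 := hinput (ρ v)
    simp only [length_encodeFields, R, List.map_cons, List.map_nil, List.sum_cons, List.sum_nil,
      length_natBits]
    nlinarith
  · intro f m M hm hmem hlen hf
    have hcert : ∀ v, certFields (m v) = [natBits ((c + 1) * L) (C.ident z), a v, b v,
        natBits L (Nat.card {w // C.graph.Adj v w}), encodeFields (R (ρ v))] := fun v => by
      rw [certFields, hm, decodeFields_encodeFields]
      exact decodeFields_encodeFields _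
    have hown : ∀ v, ownRecord (m v) = R v := fun v => by
      rw [ownRecord, hcert, hm, decodeFields_encodeFields]
      rfl
    have hownR : (fun v => ownRecord (m v)) = R := funext hown
    refine forall_nodeVerdict_of_relay hmem hlen hC.ident_injective hρ hz (hownR ▸ hR) ?_ ?_ ?_ hG ?_
    · intro v
      rw [rootIdent, hcert, hown]
      rfl
    · intro v
      rw [relayedRecord, hcert, hown]
      exact decodeFields_encodeFields _
    · intro v
      rw [hown]
      exact bitsVal_natBits (hdeglt v)
    · intro S hnd hS
      exact hf R S hR hRinj hnd (by simpa only [hown] using hS)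

end Main

end DistributedProof

open DistributedProof
/-- For every distributed language `L`, its restriction to cographs has a distributed interactive
proof with two rounds, shared randomness and bandwidth `O(log n)`, and with error probability
at most `1 / 3` and at most `1 / n ^ k`, for any prescribed `k`. -/
theorem mainTheorem2 (c d k : ℕ) (L : Set NetworkConfig) (hL : IsDistributedLanguage L) :
    restrictToCographs L ∈
      dAMPub c d (fun n => min (1 / 3 : ℝ) (1 / (n : ℝ) ^ k)) (fun n => Nat.log 2 n + 1) := by
  classical
  obtain ⟨p, hp, hLp⟩ := hL.decidable
  obtain ⟨f, hf, rfl⟩ := ComputablePred.computable_iff.1 hp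
  let K := 6 * c + 4 * d + 66
  have hε : ∀ n : ℕ, (0 : ℝ) ≤ min (1 / 3 : ℝ) (1 / (n : ℝ) ^ k) := fun n =>
    le_min (by norm_num) (by positivity)
  refine ⟨cographVerifier c K f hf, 2 * (c + 1 + d + K) + 6, fun C hC => ⟨?_, ?_, ?_⟩⟩
  · intro r v cert
    exact length_nodeMessage_le (Nat.le_add_left 1 _) ((length_view_coins r v cert).trans (one_mul _))
      (hC.input_le v)
  · rintro ⟨hCL, hG⟩
    obtain ⟨cert, hcert, hacc⟩ := exists_certificates hC hG
    refine ⟨fun _ => cert, fun r v => (hcert v).trans (Nat.mul_le_mul_right _ (by omega)), ?_⟩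
    rw [coinProb_eq_one fun r v => ?_]
    · linarith [hε C.n]
    rw [cographVerifier_acceptsAt (fun _ => rfl)]
    refine hacc f _ _ (fun v => ?_) (mem_neighbour_messages _) (length_neighbour_messages _)
      (fun R S hR hinj hnd hS => (mem_iff_recordCode hL (p := fun x => f x = true) hLp hR hinj hnd hS).1 hCL) v
    have hlen := (length_view_coins r v (cert v)).trans (one_mul (Nat.log 2 C.n + 1))
    rw [nodeMessage, hlen]
    change encodeFields [_, _, if (cert v).length ≤ K * _ then cert v else []] = _
    rw [if_pos (hcert v)]
    rfl
  · intro hCL P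
    rw [coinProb_eq_one fun r => ?_]
    · linarith [hε C.n]
    by_contra! hacc
    simp only [cographVerifier_acceptsAt (fun _ => rfl)] at hacc
    have hfields : ∀ v, ∃ x, decodeFields (nodeMessage c K (C.view r v (P r v))) =
        [natBits ((c + 1) * (Nat.log 2 C.n + 1)) (C.ident v), C.input v, x] := fun v => by
      have hlen := (length_view_coins r v (P r v)).trans (one_mul (Nat.log 2 C.n + 1))
      rw [nodeMessage, hlen, decodeFields_encodeFields]
      exact ⟨_, rfl⟩
    obtain ⟨S, hnd, hS, hR, hcog, hfS⟩ := sound_of_forall_nodeVerdict hC.connected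
      hC.ident_injective (mem_neighbour_messages _) (length_neighbour_messages _)
      (fun v => by
        obtain ⟨x, hx⟩ := hfields v
        rw [ownRecord, hx]
        exact bitsVal_natBits (hC.ident_lt v))
      (fun v => by
        obtain ⟨x, hx⟩ := hfields v
        rw [ownRecord, hx]
        rfl) hacc
    have hinj : Function.Injective fun v => ownRecord (nodeMessage c K (C.view r v (P r v))) :=
      fun v w h => hC.ident_injective (by
        rw [← hR.ident_eq, ← hR.ident_eq]
        exact congrArg (fun x : Record => bitsVal (x.getD 0 [])) h)
    exact hCL ⟨(mem_iff_recordCode hL (p := fun x => f x = true) hLp hR hinj hnd hS).2 hfS, (cographCheck_iff hR hS).1 hcog⟩
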